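/- Let $\mathfrak C$ be a category. A *semilattice direct system* in $\mathfrak C$ is a triple $\langle X_i,p_{ii'},I\rangle$ where $I$ is a join semilattice with least element, each $X_i$ ($i\in I$) is an object of $\mathfrak C$, and $p_{ii'}\colon X_i\to X_{i'}$ ($i\le i'$) are morphisms with $p_{ii}=\mathrm{id}$ and $p_{i'i''}\circ p_{ii'}=p_{ii''}$ for $i\le i'\le i''$. A morphism $\langle X_i,p_{ii'},I\rangle\to\langle Y_j,q_{jj'},J\rangle$ is a pair $(\varphi,(f_i)_{i\in I})$ with $\varphi\colon I\to J$ a semilattice homomorphism and $f_i\colon X_i\to Y_{\varphi(i)}$ morphisms of $\mathfrak C$ such that $f_{i'}\circ p_{ii'}=q_{\varphi(i)\varphi(i')}\circ f_i$ for $i\le i'$. Composition is $(\psi,g)\circ(\varphi,f)=(\psi\varphi,(g_{\varphi(i)}f_i)_i)$. This gives the category Sem-dir-$\mathfrak C$. A *semilattice inverse system* in $\mathfrak C$ is a triple $\langle X_i,p_{ii'},I\rangle$ with $I$ and $X_i$ as before and morphisms $p_{ii'}\colon X_{i'}\to X_i$ ($i\le i'$) with $p_{ii}=\mathrm{id}$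 and $p_{ii'}\circ p_{i'i''}=p_{ii''}$ for $i\le i'\le i''$. A morphism $\langle X_i,p_{ii'},I\rangle\to\langle Y_j,q_{jj'},J\rangle$ is a pair $(\varphi,(f_j)_{j\in J})$ with $\varphi\colon J\to I$ a semilattice homomorphism and $f_j\colon X_{\varphi(j)}\to Y_j$ morphisms of $\mathfrak C$ such that $f_j\circ p_{\varphi(j)\varphi(j')}=q_{jj'}\circ f_{j'}$ for $j\le j'$. Composition is $(\psi,g)\circ(\varphi,f)=(\varphi\psi,(g_kf_{\psi(k)})_k)$. This gives the category Sem-inv-$\mathfrak C$. Two categories are *dually equivalent* if there are contravariant functors between them, in opposite directions, whose two composites are naturally isomorphic to the identity functors. Let $\mathfrak{BA}$ be the category of Boolean algebras and their homomorphisms, and $\mathfrak{SA}$ the category of Stone spaces (compact, Hausdorff, totally disconnected spaces) and continuous maps. **Corollary.** The categories Sem-dir-$\mathfrak{BA}$ and Sem-inv-$\mathfrak{SA}$ are dually equivalent. This holds both when "semilattice homomorphism" means a map preserving binary joins, and when it means a map preserving binary joins and the least element (the same meaning being used on both sides). -/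

import Mathlib

open CategoryTheory

universe w v u

/-! ## Semilattice direct systems -/

/-- A semilattice direct system `⟨X i, p i i', I⟩` in a category `C`: the index set `I` is a join
semilattice with least element, the terms `X i` are objects of `C`, and the transition morphisms
`p i i' : X i ⟶ X i'`, for `i ≤ i'`, are functorial. -/
structure SemDir (C : Type u) [Category.{v} C] where
  /-- the index set -/
  I : Type w
  [semilatticeSup : SemilatticeSup I]
  [orderBot : OrderBot I]
  /-- the terms -/
  X : I → C
  /-- the transition morphisms -/
  p : ∀ {i i' : I}, i ≤ i' → (X i ⟶ X i')
  p_refl : ∀ i : I, p (le_refl i) = 𝟙 (X i)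
  p_trans : ∀ {i i' i'' : I} (h : i ≤ i') (h' : i' ≤ i''),
    p h ≫ p h' = p (h.trans h')

namespace SemDir

attribute [instance] SemDir.semilatticeSup SemDir.orderBot

variable {C : Type u} [Category.{v} C]

/-- A morphism `(φ, f)` of semilattice direct systems: `φ : I → J` is a homomorphism of join
semilattices, `f i : X i ⟶ Y (φ i)`, and the squares with the transition morphisms commute. -/
structure Hom (A B : SemDir.{w} C) where
  /-- the map of index sets -/
  φ : SupHom A.I B.I
  /-- the components -/
  f : ∀ i : A.I, A.X i ⟶ B.X (φ i)
  comm : ∀ {i i' : A.I} (h : i ≤ i'),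
    A.p h ≫ f i' = f i ≫ B.p (OrderHomClass.mono φ h)

/-- The identity is the identity on the index set, with identity components. -/
def Hom.id (A : SemDir.{w} C) : Hom A A where
  φ := SupHom.id A.I
  f i := 𝟙 (A.X i)
  comm _ := (Category.comp_id _).trans (Category.id_comp _).symm

/-- The composite of `(φ, f)` and `(ψ, g)` is `(ψ ∘ φ, h)` with `h i = g (φ i) ∘ f i`. -/
def Hom.comp {A B D : SemDir.{w} C} (F : Hom A B) (G : Hom B D) : Hom A D where
  φ := G.φ.comp F.φ
  f i := F.f i ≫ G.f (F.φ i)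
  comm {i i'} h := by
    have h1 : A.p h ≫ F.f i' ≫ G.f (F.φ i') =
        (F.f i ≫ G.f (F.φ i)) ≫ D.p (OrderHomClass.mono G.φ (OrderHomClass.mono F.φ h)) := by
      rw [← Category.assoc, F.comm h, Category.assoc, G.comm, Category.assoc]
    exact h1

theorem Hom.ext_of_f {A B : SemDir.{w} C} (φ : SupHom A.I B.I)
    {f g : ∀ i : A.I, A.X i ⟶ B.X (φ i)} {hf hg} (h : ∀ i, f i = g i) :
    (⟨φ, f, hf⟩ : Hom A B) = ⟨φ, g, hg⟩ := by
  obtain rfl : f = g := funext h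
  rfl

/-- The category of semilattice direct systems in `C`. -/
instance : Category (SemDir.{w} C) where
  Hom := Hom
  id := Hom.id
  comp := Hom.comp
  id_comp F := Hom.ext_of_f F.φ fun _ => Category.id_comp _
  comp_id F := Hom.ext_of_f F.φ fun _ => Category.comp_id _
  assoc F G H := Hom.ext_of_f (H.φ.comp (G.φ.comp F.φ)) fun _ => Category.assoc _ _ _

variable (C) in
/-- The morphisms whose index map also preserves the least element. -/
def preservesBot : MorphismProperty (SemDir.{w} C) :=
  fun _ _ F => Hom.φ F ⊥ = ⊥

instance : (preservesBot.{w} C).IsMultiplicative where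
  id_mem _ := rfl
  comp_mem _ G hF hG := (congrArg (Hom.φ G) hF).trans hG

end SemDir

/-! ## Semilattice inverse systems -/

/-- A semilattice inverse system `⟨X i, p i i', I⟩` in a category `C`: the index set `I` is a join
semilattice with least element, the terms `X i` are objects of `C`, and the bonding morphisms
`p i i' : X i' ⟶ X i`, for `i ≤ i'`, are functorial. -/
structure SemInv (C : Type u) [Category.{v} C] where
  /-- the index set -/
  I : Type w
  [semilatticeSup : SemilatticeSup I]
  [orderBot : OrderBot I]
  /-- the terms -/
  X : I → C
  /-- the bonding morphisms -/
  p : ∀ {i i' : I}, i ≤ i' → (X i' ⟶ X i)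
  p_refl : ∀ i : I, p (le_refl i) = 𝟙 (X i)
  p_trans : ∀ {i i' i'' : I} (h : i ≤ i') (h' : i' ≤ i''),
    p h' ≫ p h = p (h.trans h')

namespace SemInv

attribute [instance] SemInv.semilatticeSup SemInv.orderBot

variable {C : Type u} [Category.{v} C]

/-- A morphism `(φ, f)` from `⟨X i, p i i', I⟩` to `⟨Y j, q j j', J⟩`: `φ : J → I` is a homomorphism
of join semilattices, `f j : X (φ j) ⟶ Y j`, and the squares with the bonding morphisms commute. -/
structure Hom (A B : SemInv.{w} C) where
  /-- the map of index sets -/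
  φ : SupHom B.I A.I
  /-- the components -/
  f : ∀ j : B.I, A.X (φ j) ⟶ B.X j
  comm : ∀ {j j' : B.I} (h : j ≤ j'),
    A.p (OrderHomClass.mono φ h) ≫ f j = f j' ≫ B.p h

/-- The identity is the identity on the index set, with identity components. -/
def Hom.id (A : SemInv.{w} C) : Hom A A where
  φ := SupHom.id A.I
  f i := 𝟙 (A.X i)
  comm _ := (Category.comp_id _).trans (Category.id_comp _).symm

/-- The composite of `(φ, f)` and `(ψ, g)` is `(φ ∘ ψ, h)` with `h k = g k ∘ f (ψ k)`. -/
def Hom.comp {A B D : SemInv.{w} C} (F : Hom A B) (G : Hom B D) : Hom A D where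
  φ := F.φ.comp G.φ
  f k := F.f (G.φ k) ≫ G.f k
  comm {k k'} h := by
    have h1 : A.p (OrderHomClass.mono F.φ (OrderHomClass.mono G.φ h : G.φ k ≤ G.φ k')) ≫ F.f (G.φ k) ≫ G.f k =
        (F.f (G.φ k') ≫ G.f k') ≫ D.p h := by
      rw [← Category.assoc, F.comm (OrderHomClass.mono G.φ h), Category.assoc, G.comm h, Category.assoc]
    exact h1

theorem Hom.ext_of_f {A B : SemInv.{w} C} (φ : SupHom B.I A.I)
    {f g : ∀ j : B.I, A.X (φ j) ⟶ B.X j} {hf hg} (h : ∀ j, f j = g j) :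
    (⟨φ, f, hf⟩ : Hom A B) = ⟨φ, g, hg⟩ := by
  obtain rfl : f = g := funext h
  rfl

/-- The category of semilattice inverse systems in `C`. -/
instance : Category (SemInv.{w} C) where
  Hom := Hom
  id := Hom.id
  comp := Hom.comp
  id_comp F := Hom.ext_of_f F.φ fun _ => Category.id_comp _
  comp_id F := Hom.ext_of_f F.φ fun _ => Category.comp_id _
  assoc F G H := Hom.ext_of_f (F.φ.comp (G.φ.comp H.φ)) fun _ => Category.assoc _ _ _

variable (C) in
/-- The morphisms whose index map also preserves the least element. -/
def preservesBot : MorphismProperty (SemInv.{w} C) :=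
  fun _ _ F => Hom.φ F ⊥ = ⊥

instance : (preservesBot.{w} C).IsMultiplicative where
  id_mem _ := rfl
  comp_mem F _ hF hG := (congrArg (Hom.φ F) hG).trans hF

end SemInv

/-- Two categories are dually equivalent if there are contravariant functors between them, in
opposite directions, whose two composites are naturally isomorphic to the identities. -/
def DuallyEquivalent (C : Type*) [Category C] (D : Type*) [Category D] : Prop :=
  Nonempty (Cᵒᵖ ≌ D)

/-! ## Stone duality -/

/-! The result has two independent ingredients. The first is Stone duality. A Boolean algebra `A` is
recovered as the clopen algebra of its space of homomorphisms to `Bool`: the prime ideal theorem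
makes `a ↦ {f | f a = true}` an order embedding, and compactness makes it surjective. A Stone space
is recovered because every homomorphism from its clopens to `Bool` is evaluation at a unique point,
again by compactness.

The second is formal: any duality `Cᵒᵖ ≌ D` lifts to systems. Applied termwise, a contravariant
functor reverses transition maps and components but leaves index semilattices and index maps alone.
The unit and counit, taken termwise with identity index maps, are morphisms of systems and are
natural in the system, both by the naturality of the original unit and counit. Since index maps
never change, preservation of the least element is carried along, which gives the second version. -/

/-- The Boolean-valued homomorphisms of a Boolean algebra, as a set of functions. -/
def stoneSpectrum (A : Type u) [BooleanAlgebra A] : Set (A → Bool) :=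
  {f | f ⊤ = true ∧ f ⊥ = false ∧ (∀ a b, f (a ⊓ b) = (f a && f b)) ∧
    ∀ a b, f (a ⊔ b) = (f a || f b)}

namespace stoneSpectrum

variable {A : Type u} [BooleanAlgebra A]

/-- Each homomorphism condition equates two continuous functions of finitely many coordinates.
Compactness of the spectrum then follows from that of the product `A → Bool`. -/
theorem isClosed : IsClosed (stoneSpectrum A) := by
  have heq : stoneSpectrum A = {f | f ⊤ = true} ∩ ({f | f ⊥ = false} ∩
      ((⋂ a, ⋂ b, {f | f (a ⊓ b) = (f a && f b)}) ∩
        ⋂ a, ⋂ b, {f | f (a ⊔ b) = (f a || f b)})) := by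
    ext f
    simp only [stoneSpectrum, Set.mem_inter_iff, Set.mem_iInter]
    exact Iff.rfl
  rw [heq]
  have h : ∀ a : A, Continuous fun f : A → Bool => f a := continuous_apply
  have hand : Continuous fun p : Bool × Bool => (p.1 && p.2) := continuous_of_discreteTopology
  have hor : Continuous fun p : Bool × Bool => (p.1 || p.2) := continuous_of_discreteTopology
  refine (isClosed_eq (h _) continuous_const).inter
    ((isClosed_eq (h _) continuous_const).inter (.inter ?_ ?_))
  · exact isClosed_iInter fun a => isClosed_iInter fun b =>
      isClosed_eq (h _) (hand.comp ((h a).prodMk (h b)))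
  · exact isClosed_iInter fun a => isClosed_iInter fun b =>
      isClosed_eq (h _) (hor.comp ((h a).prodMk (h b)))

instance : CompactSpace (stoneSpectrum A) := isCompact_iff_compactSpace.mp (isClosed (A := A)).isCompact

theorem map_compl (f : stoneSpectrum A) (a : A) : f.1 aᶜ = !f.1 a := by
  have h1 : f.1 ⊥ = (f.1 a && f.1 aᶜ) := inf_compl_eq_bot (a := a) ▸ f.2.2.2.1 a aᶜ
  have h2 : f.1 ⊤ = (f.1 a || f.1 aᶜ) := sup_compl_eq_top (x := a) ▸ f.2.2.2.2 a aᶜ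
  rw [f.2.2.1] at h1
  rw [f.2.1] at h2
  revert h1 h2
  cases f.1 a <;> cases f.1 aᶜ <;> decide

/-- The basic clopen set of the homomorphisms sending `a` to `true`. -/
def basicClopen (a : A) : TopologicalSpace.Clopens (stoneSpectrum A) :=
  ⟨{f | f.1 a = true},
    (isClopen_discrete {true}).preimage ((continuous_apply a).comp continuous_subtype_val)⟩

theorem mem_basicClopen {a : A} {f : stoneSpectrum A} : f ∈ basicClopen a ↔ f.1 a = true := Iff.rfl

theorem exists_of_not_le {a b : A} (h : ¬ a ≤ b) :
    ∃ f : stoneSpectrum A, f.1 a = true ∧ f.1 b = false := by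
  classical
  obtain ⟨J, hJ, hbJ, hd⟩ := DistribLattice.prime_ideal_of_disjoint_filter_ideal
    (F := Order.PFilter.principal a) (I := Order.Ideal.principal b) (by
      rw [Set.disjoint_left]
      intro c hc hc'
      exact h (le_trans (Order.PFilter.mem_principal.mp hc) (Order.Ideal.mem_principal.mp hc')))
  have hmem : b ∈ J := hbJ (Order.Ideal.mem_principal.mpr le_rfl)
  have hna : a ∉ J := Set.disjoint_left.mp hd (Order.PFilter.mem_principal.mpr le_rfl)
  -- The witness is the indicator of the complement of `J`; primality is what makes it preserve
  -- meets.
  refine ⟨⟨fun c => decide (c ∉ J), ?_, ?_, fun x y => ?_, fun x y => ?_⟩, ?_, ?_⟩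
  · exact decide_eq_true fun ht => hna (J.lower le_top ht)
  · simp
  · have : x ⊓ y ∈ J ↔ x ∈ J ∨ y ∈ J :=
      ⟨hJ.mem_or_mem, fun h => h.elim (J.lower inf_le_left) (J.lower inf_le_right)⟩
    simp [this]
  · by_cases hx : x ∈ J <;> by_cases hy : y ∈ J <;> simp [hx, hy]
  · simpa using hna
  · simpa using hmem

theorem basicClopen_le_iff {a b : A} : basicClopen a ≤ basicClopen b ↔ a ≤ b := by
  refine ⟨fun h => ?_, fun h f hf => ?_⟩
  · by_contra hab
    obtain ⟨f, ha, hb⟩ := exists_of_not_le hab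
    have := mem_basicClopen.mp (h (mem_basicClopen.mpr ha))
    simp_all
  · rw [mem_basicClopen] at hf ⊢
    have := f.2.2.2.2 a b
    rw [sup_eq_right.mpr h, hf] at this
    simpa using this

theorem exists_separating {x y : stoneSpectrum A} (h : x ≠ y) :
    ∃ a, x.1 a = true ∧ y.1 a = false := by
  obtain ⟨a, ha⟩ := Function.ne_iff.mp (fun h' => h (Subtype.ext h'))
  cases hx : x.1 a
  · refine ⟨aᶜ, ?_, ?_⟩ <;> rw [map_compl] <;> simp_all
  · exact ⟨a, hx, by simp_all⟩

/-- The basic clopens form a base: each point of the compact set `Uᶜ` is separated from `x` by one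
of them, and finitely many separators are combined by a meet. -/
theorem exists_basicClopen_subset {U : Set (stoneSpectrum A)} (hU : IsOpen U)
    {x : stoneSpectrum A} (hx : x ∈ U) : ∃ a, x ∈ basicClopen a ∧ (basicClopen a : Set _) ⊆ U := by
  have key : ∃ a, x ∈ basicClopen a ∧ Disjoint Uᶜ (basicClopen a : Set (stoneSpectrum A)) := by
    refine hU.isClosed_compl.isCompact.induction_on
      (p := fun s => ∃ a, x ∈ basicClopen a ∧ Disjoint s (basicClopen a : Set (stoneSpectrum A)))
      ⟨⊤, x.2.1, Set.empty_disjoint _⟩ ?_ ?_ ?_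
    · rintro s t hst ⟨a, ha, hd⟩
      exact ⟨a, ha, hd.mono_left hst⟩
    · rintro s t ⟨a, ha, hd⟩ ⟨b, hb, hd'⟩
      have hle : basicClopen (a ⊓ b) ≤ basicClopen a := basicClopen_le_iff.mpr inf_le_left
      have hle' : basicClopen (a ⊓ b) ≤ basicClopen b := basicClopen_le_iff.mpr inf_le_right
      refine ⟨a ⊓ b, ?_, Set.disjoint_union_left.mpr ⟨hd.mono_right hle, hd'.mono_right hle'⟩⟩
      rw [mem_basicClopen] at *
      rw [x.2.2.2.1, ha, hb]
      rfl
    · intro y hy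
      obtain ⟨a, hxa, hya⟩ := exists_separating (x := x) (y := y) (fun h => hy (h ▸ hx))
      refine ⟨(basicClopen aᶜ : Set _), mem_nhdsWithin_of_mem_nhds
        ((basicClopen aᶜ).isClopen.isOpen.mem_nhds ?_), a, hxa, ?_⟩
      · change y.1 aᶜ = true
        rw [map_compl, hya]
        rfl
      · rw [Set.disjoint_left]
        intro z hz hz'
        change z.1 aᶜ = true at hz
        change z.1 a = true at hz'
        rw [map_compl, hz'] at hz
        simp at hz
  obtain ⟨a, ha, hd⟩ := key
  exact ⟨a, ha, Set.disjoint_compl_left_iff_subset.mp hd⟩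

theorem basicClopen_surjective : Function.Surjective (basicClopen (A := A)) := by
  intro U
  obtain ⟨a, h1, h2⟩ : ∃ a : A, (U : Set (stoneSpectrum A)) ⊆ basicClopen a ∧
      (basicClopen a : Set (stoneSpectrum A)) ⊆ U := by
    -- Finitely many basic clopens inside `U` cover it, and their union is the basic clopen of a
    -- join.
    refine U.isClopen.isClosed.isCompact.induction_on
      (p := fun s => ∃ a : A, s ⊆ (basicClopen a : Set (stoneSpectrum A)) ∧
        (basicClopen a : Set (stoneSpectrum A)) ⊆ U)
      ⟨⊥, Set.empty_subset _, ?_⟩ ?_ ?_ ?_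
    · intro f hf
      exact absurd (f.2.2.1.symm.trans hf) (by simp)
    · rintro s t hst ⟨a, ha, hd⟩
      exact ⟨a, hst.trans ha, hd⟩
    · rintro s t ⟨a, ha, hd⟩ ⟨b, hb, hd'⟩
      have hle : basicClopen a ≤ basicClopen (a ⊔ b) := basicClopen_le_iff.mpr le_sup_left
      have hle' : basicClopen b ≤ basicClopen (a ⊔ b) := basicClopen_le_iff.mpr le_sup_right
      refine ⟨a ⊔ b, Set.union_subset (ha.trans hle) (hb.trans hle'), fun f hf => ?_⟩
      change f.1 (a ⊔ b) = true at hf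
      rw [f.2.2.2.2, Bool.or_eq_true] at hf
      exact hf.elim (fun h => hd h) (fun h => hd' h)
    · intro x hx
      obtain ⟨a, ha, hs⟩ := exists_basicClopen_subset U.isClopen.isOpen hx
      exact ⟨(basicClopen a : Set _), mem_nhdsWithin_of_mem_nhds
        ((basicClopen a).isClopen.isOpen.mem_nhds ha), a, subset_rfl, hs⟩
  exact ⟨a, SetLike.coe_injective (h2.antisymm h1)⟩

/-- A Boolean algebra is isomorphic to the clopen algebra of its spectrum. -/
noncomputable def orderIsoClopens : A ≃o TopologicalSpace.Clopens (stoneSpectrum A) :=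
  RelIso.ofSurjective (OrderEmbedding.ofMapLEIff basicClopen fun _ _ => basicClopen_le_iff)
    basicClopen_surjective

/-- Precomposition with a homomorphism of Boolean algebras. -/
def comap {B : Type u} [BooleanAlgebra B] (g : BoundedLatticeHom A B) :
    C(stoneSpectrum B, stoneSpectrum A) where
  toFun f := ⟨fun a => f.1 (g a), by simp [f.2.1], by simp [f.2.2.1],
    fun a b => by simp only [map_inf, f.2.2.2.1], fun a b => by simp only [map_sup, f.2.2.2.2]⟩
  continuous_toFun := Continuous.subtype_mk
    (continuous_pi fun a => (continuous_apply (A := fun _ => Bool) (g a)).comp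
      (f := fun f : stoneSpectrum B => f.1) continuous_subtype_val) _

/-! ### Points of a Stone space as homomorphisms on its clopens -/

section Points

variable (X : Type u) [TopologicalSpace X]

open scoped Classical in
/-- Evaluation of clopen sets at a point. -/
noncomputable def evalClopens :
    C(X, stoneSpectrum (TopologicalSpace.Clopens X)) where
  toFun x := ⟨fun U => decide (x ∈ U), decide_eq_true (Set.mem_univ x),
    decide_eq_false (Set.notMem_empty x),
    fun U V => by rw [← Bool.decide_and]; exact decide_eq_decide.mpr Iff.rfl,
    fun U V => by rw [← Bool.decide_or]; exact decide_eq_decide.mpr Iff.rfl⟩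
  continuous_toFun := by
    refine Continuous.subtype_mk (continuous_pi fun U => ?_) _
    refine (IsLocallyConstant.iff_exists_open _).mpr (fun x => ?_) |>.continuous
    by_cases hx : x ∈ U
    · exact ⟨U, U.isClopen.isOpen, hx, fun y hy => by
        rw [decide_eq_true hx, decide_eq_true (show y ∈ U from hy)]⟩
    · exact ⟨(U : Set X)ᶜ, U.isClopen.compl.isOpen, hx, fun y hy => by
        rw [decide_eq_false hx, decide_eq_false (show y ∉ U from hy)]⟩

variable {X}

theorem evalClopens_apply_iff {x : X} {U : TopologicalSpace.Clopens X} :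
    (evalClopens X x).1 U = true ↔ x ∈ U := by
  simp [evalClopens]

theorem evalClopens_bijective [CompactSpace X] [T2Space X] [TotallyDisconnectedSpace X] :
    Function.Bijective (evalClopens X) := by
  refine ⟨fun x y h => ?_, fun f => ?_⟩
  · by_contra hne
    obtain ⟨U, hU, hx, hy⟩ := exists_isClopen_of_totally_separated hne
    have h1 : (evalClopens X x).1 ⟨U, hU⟩ = true := evalClopens_apply_iff.mpr hx
    rw [h] at h1
    exact hy (evalClopens_apply_iff.mp h1)
  · have : Nonempty {U : TopologicalSpace.Clopens X // f.1 U = true} := ⟨⟨⊤, f.2.1⟩⟩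
    -- The clopens on which `f` is true are closed under meets and nonempty, so compactness gives
    -- them a common point.
    obtain ⟨x, hx⟩ := IsCompact.nonempty_iInter_of_directed_nonempty_isCompact_isClosed
      (fun U : {U : TopologicalSpace.Clopens X // f.1 U = true} => (U.1 : Set X))
      (fun U V => ⟨⟨U.1 ⊓ V.1, by rw [f.2.2.2.1, U.2, V.2]; rfl⟩,
        Set.inter_subset_left, Set.inter_subset_right⟩)
      (fun U => by
        rw [Set.nonempty_iff_ne_empty]
        intro h
        have hU : U.1 = ⊥ := SetLike.coe_injective h
        have := U.2
        rw [hU, f.2.2.1] at this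
        exact absurd this (by simp))
      (fun U => U.1.isClopen.isClosed.isCompact) (fun U => U.1.isClopen.isClosed)
    rw [Set.mem_iInter] at hx
    refine ⟨x, Subtype.ext (funext fun U => ?_)⟩
    rw [Bool.eq_iff_iff, evalClopens_apply_iff]
    refine ⟨fun h => ?_, fun h => hx ⟨U, h⟩⟩
    by_contra hf
    -- If `f` is false on `U`, it is true on `Uᶜ`, which forces `x ∈ Uᶜ`.
    exact hx ⟨Uᶜ, by rw [map_compl]; simpa using hf⟩ h

end Points

end stoneSpectrum

/-- The preimage homomorphism between clopen algebras. -/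
def clopensComap {X Y : Type u} [TopologicalSpace X] [TopologicalSpace Y] (f : C(X, Y)) :
    BoundedLatticeHom (TopologicalSpace.Clopens Y) (TopologicalSpace.Clopens X) where
  toFun U := ⟨f ⁻¹' U, U.isClopen.preimage f.continuous⟩
  map_sup' _ _ := rfl
  map_inf' _ _ := rfl
  map_top' := rfl
  map_bot' := rfl

/-- The functor sending a Boolean algebra to its Stone space. -/
def stoneFunctor : BoolAlg.{u}ᵒᵖ ⥤ Profinite.{u} where
  obj A := Profinite.of (stoneSpectrum A.unop)
  map g := CompHausLike.ofHom _ (stoneSpectrum.comap g.unop.hom)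
  map_id _ := rfl
  map_comp _ _ := rfl

/-- The functor sending a Stone space to its algebra of clopen sets. -/
def clopensFunctor : Profinite.{u} ⥤ BoolAlg.{u}ᵒᵖ where
  obj X := .op (.of (TopologicalSpace.Clopens X))
  map f := (BoolAlg.ofHom (clopensComap f.hom.hom)).op
  map_id _ := rfl
  map_comp _ _ := rfl

/-- The clopen algebra of the spectrum, as an isomorphism in the category of Boolean algebras. -/
noncomputable def stoneUnitIso (A : BoolAlg.{u}) :
    A ≅ BoolAlg.of (TopologicalSpace.Clopens (stoneSpectrum A)) :=
  BoolAlg.Iso.mk stoneSpectrum.orderIsoClopens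

/-- The spectrum of the clopen algebra, as an isomorphism in the category of Stone spaces. -/
noncomputable def stoneCounitIso (X : Profinite.{u}) :
    X ≅ Profinite.of (stoneSpectrum (TopologicalSpace.Clopens X)) :=
  CompHausLike.isoOfBijective
    (CompHausLike.ofHom _ (stoneSpectrum.evalClopens X)
      : X ⟶ Profinite.of (stoneSpectrum (TopologicalSpace.Clopens X)))
    stoneSpectrum.evalClopens_bijective

/-- Stone duality: Boolean algebras are dual to Stone spaces. -/
noncomputable def stoneDuality : BoolAlg.{u}ᵒᵖ ≌ Profinite.{u} :=
  CategoryTheory.Equivalence.mk stoneFunctor clopensFunctor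
    (NatIso.ofComponents (fun A => (stoneUnitIso A.unop).op) fun _ => rfl).symm
    (NatIso.ofComponents (F := 𝟭 Profinite.{u}) (G := clopensFunctor ⋙ stoneFunctor)
      stoneCounitIso fun _ => rfl).symm

/-! ## Lifting a duality to systems -/

/-- The types of the components depend on the index map, hence the heterogeneous equality. In the
uses below the index maps agree by `rfl`. -/
theorem SemDir.Hom.ext_of_heq {C : Type*} [Category C] {A B : SemDir.{w} C} {F G : Hom A B}
    (hφ : F.φ = G.φ) (hf : ∀ i, F.f i ≍ G.f i) : F = G := by
  obtain ⟨φ, f, _⟩ := F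
  obtain ⟨ψ, g, _⟩ := G
  obtain rfl : φ = ψ := hφ
  exact Hom.ext_of_f φ fun i => eq_of_heq (hf i)

theorem SemInv.Hom.ext_of_heq {C : Type*} [Category C] {A B : SemInv.{w} C} {F G : Hom A B}
    (hφ : F.φ = G.φ) (hf : ∀ j, F.f j ≍ G.f j) : F = G := by
  obtain ⟨φ, f, _⟩ := F
  obtain ⟨ψ, g, _⟩ := G
  obtain rfl : φ = ψ := hφ
  exact Hom.ext_of_f φ fun i => eq_of_heq (hf i)

section Lift

variable {C : Type*} [Category C] {D : Type*} [Category D]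

/-- A contravariant functor turns direct systems into inverse systems. -/
def SemDir.mapOp (F : Cᵒᵖ ⥤ D) : (SemDir.{w} C)ᵒᵖ ⥤ SemInv.{w} D where
  obj A :=
    { I := A.unop.I
      X i := F.obj (.op (A.unop.X i))
      p h := F.map (A.unop.p h).op
      p_refl i := by rw [A.unop.p_refl, op_id, F.map_id]
      p_trans h h' := by rw [← F.map_comp, ← op_comp, A.unop.p_trans] }
  map {A B} g :=
    { φ := Hom.φ g.unop
      f j := F.map (Hom.f g.unop j).op
      comm h := by
        rw [← F.map_comp, ← F.map_comp, ← op_comp, ← op_comp]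
        exact congrArg (fun t => F.map t.op) (Hom.comm g.unop h).symm }
  map_id A := SemInv.Hom.ext_of_heq rfl fun i => heq_of_eq (F.map_id _)
  map_comp f g := SemInv.Hom.ext_of_heq rfl fun i => heq_of_eq (F.map_comp _ _)

/-- A contravariant functor turns inverse systems into direct systems. -/
def SemInv.mapOp (G : D ⥤ Cᵒᵖ) : SemInv.{w} D ⥤ (SemDir.{w} C)ᵒᵖ where
  obj A := .op
    { I := A.I
      X i := (G.obj (A.X i)).unop
      p h := (G.map (A.p h)).unop
      p_refl i := by rw [A.p_refl, G.map_id, unop_id]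
      p_trans h h' := by rw [← unop_comp, ← G.map_comp, A.p_trans] }
  map {A B} g := Quiver.Hom.op (V := SemDir.{w} C)
    { φ := Hom.φ g
      f j := (G.map (Hom.f g j)).unop
      comm h := by
        rw [← unop_comp, ← unop_comp, ← G.map_comp, ← G.map_comp]
        exact congrArg (fun t => (G.map t).unop) (Hom.comm g h).symm }
  map_id A := congrArg Quiver.Hom.op (SemDir.Hom.ext_of_heq rfl
    fun i => heq_of_eq (congrArg Quiver.Hom.unop (G.map_id _)))
  map_comp f g := congrArg Quiver.Hom.op (SemDir.Hom.ext_of_heq rfl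
    fun i => heq_of_eq (congrArg Quiver.Hom.unop (G.map_comp _ _)))

/-- An isomorphism of direct systems that is the identity on indices. -/
def SemDir.isoOfComponents {A : SemDir.{w} C} {X : A.I → C}
    {p : ∀ {i i' : A.I}, i ≤ i' → (X i ⟶ X i')} {hr ht} (e : ∀ i, A.X i ≅ X i)
    (h : ∀ {i i' : A.I} (h : i ≤ i'), A.p h ≫ (e i').hom = (e i).hom ≫ p h) :
    A ≅ (⟨A.I, X, p, hr, ht⟩ : SemDir.{w} C) where
  hom := ⟨SupHom.id A.I, fun i => (e i).hom, h⟩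
  inv := Hom.mk (A := ⟨A.I, X, p, hr, ht⟩) (B := A) (SupHom.id A.I) (fun i => (e i).inv)
    fun {i i'} hi => (by rw [Iso.eq_inv_comp, ← Category.assoc, ← h hi, Category.assoc,
      Iso.hom_inv_id, Category.comp_id] : p hi ≫ (e i').inv = (e i).inv ≫ A.p hi)
  hom_inv_id := SemDir.Hom.ext_of_heq rfl fun i => heq_of_eq (e i).hom_inv_id
  inv_hom_id := SemDir.Hom.ext_of_heq rfl fun i => heq_of_eq (e i).inv_hom_id

/-- An isomorphism of inverse systems that is the identity on indices. -/
def SemInv.isoOfComponents {A : SemInv.{w} C} {X : A.I → C}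
    {p : ∀ {i i' : A.I}, i ≤ i' → (X i' ⟶ X i)} {hr ht} (e : ∀ i, A.X i ≅ X i)
    (h : ∀ {i i' : A.I} (h : i ≤ i'), A.p h ≫ (e i).hom = (e i').hom ≫ p h) :
    A ≅ (⟨A.I, X, p, hr, ht⟩ : SemInv.{w} C) where
  hom := ⟨SupHom.id A.I, fun i => (e i).hom, h⟩
  inv := Hom.mk (A := ⟨A.I, X, p, hr, ht⟩) (B := A) (SupHom.id A.I) (fun i => (e i).inv)
    fun {i i'} hi => (by rw [Iso.eq_inv_comp, ← Category.assoc, ← h hi, Category.assoc,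
      Iso.hom_inv_id, Category.comp_id] : p hi ≫ (e i).inv = (e i').inv ≫ A.p hi)
  hom_inv_id := SemInv.Hom.ext_of_heq rfl fun i => heq_of_eq (e i).hom_inv_id
  inv_hom_id := SemInv.Hom.ext_of_heq rfl fun i => heq_of_eq (e i).inv_hom_id

variable (e : Cᵒᵖ ≌ D)

/-- The unit of a duality, applied componentwise to a direct system. -/
def SemDir.unitIso (A : SemDir.{w} C) :
    A ≅ ((SemDir.mapOp e.functor ⋙ SemInv.mapOp e.inverse).obj (.op A)).unop :=
  -- `unop` reverses arrows, so the inverse of the unit yields the maps out of `A.X i`.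
  SemDir.isoOfComponents (fun i => (e.unitIso.symm.app (.op (A.X i))).unop) fun h =>
    (congrArg Quiver.Hom.unop (e.unitIso.inv.naturality (A.p h).op)).symm

theorem SemDir.unitIso_naturality {A B : SemDir.{w} C} (g : A ⟶ B) :
    g ≫ (SemDir.unitIso e B).hom = (SemDir.unitIso e A).hom ≫
      ((SemDir.mapOp e.functor ⋙ SemInv.mapOp e.inverse).map g.op).unop :=
  SemDir.Hom.ext_of_heq rfl fun i => heq_of_eq
    (congrArg Quiver.Hom.unop (e.unitIso.inv.naturality (Hom.f g i).op)).symm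

/-- The counit of a duality, applied componentwise to an inverse system. -/
def SemInv.counitIso (A : SemInv.{w} D) :
    A ≅ (SemInv.mapOp e.inverse ⋙ SemDir.mapOp e.functor).obj A :=
  SemInv.isoOfComponents (fun i => e.counitIso.symm.app (A.X i)) fun h =>
    e.counitIso.inv.naturality (A.p h)

theorem SemInv.counitIso_naturality {A B : SemInv.{w} D} (g : A ⟶ B) :
    g ≫ (SemInv.counitIso e B).hom = (SemInv.counitIso e A).hom ≫
      (SemInv.mapOp e.inverse ⋙ SemDir.mapOp e.functor).map g :=
  SemInv.Hom.ext_of_heq rfl fun i => heq_of_eq (e.counitIso.inv.naturality (Hom.f g i))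

/-- A duality between two categories lifts to direct and inverse systems. -/
def SemDir.opEquivSemInv : (SemDir.{w} C)ᵒᵖ ≌ SemInv.{w} D :=
  CategoryTheory.Equivalence.mk (SemDir.mapOp e.functor) (SemInv.mapOp e.inverse)
    (NatIso.ofComponents (fun A => (SemDir.unitIso e A.unop).op)
      fun g => congrArg Quiver.Hom.op (SemDir.unitIso_naturality e g.unop).symm).symm
    (NatIso.ofComponents (F := 𝟭 _) (G := SemInv.mapOp e.inverse ⋙ SemDir.mapOp e.functor)
      (SemInv.counitIso e) fun g => SemInv.counitIso_naturality e g).symm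

/-- The restriction of `SemDir.mapOp` to the morphisms that preserve the least index. -/
def SemDir.wideMapOp (F : Cᵒᵖ ⥤ D) :
    (WideSubcategory (SemDir.preservesBot.{w} C))ᵒᵖ ⥤
      WideSubcategory (SemInv.preservesBot.{w} D) where
  obj A := ⟨(SemDir.mapOp F).obj (.op A.unop.obj)⟩
  map g := ⟨(SemDir.mapOp F).map g.unop.hom.op, g.unop.property⟩
  map_id _ := WideSubcategory.hom_ext _ ((SemDir.mapOp F).map_id _)
  map_comp f g := WideSubcategory.hom_ext _
    ((SemDir.mapOp F).map_comp f.unop.hom.op g.unop.hom.op)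

/-- The restriction of `SemInv.mapOp` to the morphisms that preserve the least index. -/
def SemInv.wideMapOp (G : D ⥤ Cᵒᵖ) :
    WideSubcategory (SemInv.preservesBot.{w} D) ⥤
      (WideSubcategory (SemDir.preservesBot.{w} C))ᵒᵖ where
  obj A := .op ⟨((SemInv.mapOp G).obj A.obj).unop⟩
  map g := Quiver.Hom.op ⟨((SemInv.mapOp G).map g.hom).unop, g.property⟩
  map_id _ := congrArg Quiver.Hom.op (WideSubcategory.hom_ext _
    (congrArg Quiver.Hom.unop ((SemInv.mapOp G).map_id _)))
  map_comp f g := congrArg Quiver.Hom.op (WideSubcategory.hom_ext _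
    (congrArg Quiver.Hom.unop ((SemInv.mapOp G).map_comp f.hom g.hom)))

/-- The duality of systems restricts to the morphisms that preserve the least index. -/
def SemDir.wideOpEquivSemInv :
    (WideSubcategory (SemDir.preservesBot.{w} C))ᵒᵖ ≌
      WideSubcategory (SemInv.preservesBot.{w} D) :=
  CategoryTheory.Equivalence.mk (SemDir.wideMapOp e.functor) (SemInv.wideMapOp e.inverse)
    (NatIso.ofComponents (F := SemDir.wideMapOp e.functor ⋙ SemInv.wideMapOp e.inverse) (G := 𝟭 _)
      -- Both directions of the isomorphism have the identity as index map, so `rfl` shows that they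
      -- preserve the least element.
      (fun A => (WideSubcategory.isoMk (Y := ((SemDir.wideMapOp e.functor ⋙
        SemInv.wideMapOp e.inverse).obj A).unop) (SemDir.unitIso e A.unop.obj) rfl rfl).op)
      fun g => congrArg Quiver.Hom.op (WideSubcategory.hom_ext _
        (SemDir.unitIso_naturality e g.unop.hom).symm)).symm
    (NatIso.ofComponents (F := 𝟭 _) (G := SemInv.wideMapOp e.inverse ⋙ SemDir.wideMapOp e.functor)
      (fun A => WideSubcategory.isoMk (SemInv.counitIso e A.obj) rfl rfl)
      fun g => WideSubcategory.hom_ext _ (SemInv.counitIso_naturality e g.hom)).symm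

end Lift

/-- Semilattice direct systems of Boolean algebras and semilattice inverse systems of Stone spaces
(compact, Hausdorff, totally disconnected) are dually equivalent, both when the index maps of the
morphisms are only required to preserve joins and when they also preserve the least element. -/
theorem mainTheorem6 :
    DuallyEquivalent (SemDir.{w} BoolAlg.{u}) (SemInv.{w} Profinite.{u}) ∧
    DuallyEquivalent (WideSubcategory (SemDir.preservesBot.{w} BoolAlg.{u}))
      (WideSubcategory (SemInv.preservesBot.{w} Profinite.{u})) :=
  ⟨⟨SemDir.opEquivSemInv stoneDuality⟩, ⟨SemDir.wideOpEquivSemInv stoneDuality⟩⟩
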